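/- Let the $B$-splines $Q_m$, $m\ge 1$, be defined by $Q_1=\chi_{[0,1)}$ and $Q_{m+1}(x)=\int_{-\infty}^{\infty}Q_m(x-t)Q_1(t)\,dt$, and let the exponential spline $\Phi_{m-1}(\beta,t)$ of degree $m-1$ to the base $t$ be $$\Phi_{m-1}(\beta,t)=\sum_{k\in\mathbb{Z}}t^k\,Q_m(\beta-k),\qquad 0\le\beta<1,\ t\in\mathbb{C}\setminus\{0\}.$$ For every integer $m\ge 2$, the zeros of $t\mapsto\Phi_{m-1}(\beta,t)$ in $\mathbb{C}\setminus\{0\}$ satisfy the following. (i) For $0<\beta<1$, all zeros are simple and are negative real numbers. (ii) For $0<\beta<\frac12$, there are exactly $\lfloor\frac m2\rfloor$ zeros in $|t|>1$ and exactly $\lfloor\frac{m-1}2\rfloor$ zeros in $|t|<1$. (iii) For $\frac12<\beta<1$, there are exactly $\lfloor\frac{m-1}2\rfloor$ zeros in $|t|>1$ and exactly $\lfloor\frac m2\rfloor$ zeros in $|t|<1$. -/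

import Mathlib

noncomputable section

/-- The `B`-splines `Q_m`, `m ≥ 1`: `Q_1` is the indicator function of `[0,1)` and
`Q_{m+1}(x) = ∫ Q_m(x - t) Q_1(t) dt`. The index `0` is a dummy value. -/
def bSpline : ℕ → ℝ → ℝ
  | 0 => 0
  | 1 => Set.indicator (Set.Ico (0 : ℝ) 1) (fun _ => 1)
  | (m + 2) => fun x => ∫ t : ℝ, bSpline (m + 1) (x - t) * bSpline 1 t

/-- The exponential spline `Φ_n(β, t) = ∑_{k ∈ ℤ} t ^ k Q_{n+1}(β - k)` of degree `n` to the
base `t`. -/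
def exponentialSpline (n : ℕ) (β : ℝ) (t : ℂ) : ℂ :=
  ∑' k : ℤ, t ^ k * (bSpline (n + 1) (β - k) : ℂ)

/-- The zeros of `t ↦ Φ_n(β, t)` in the punctured complex plane. -/
def exponentialSplineZeros (n : ℕ) (β : ℝ) : Set ℂ :=
  {t : ℂ | t ≠ 0 ∧ exponentialSpline n β t = 0}

end

open Set MeasureTheory Polynomial

/-! For `0 < β < 1` the compact support of the B-splines gives `Φ_n(β, t) = P_n(1/t)` with `P_n(x) =
∑_{j ≤ n} Q_{n+1}(β + j) x^j`, so everything is a statement about the roots of `P_n`. The three-term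
recurrence for B-splines becomes `(n+1) P_{n+1} = (β + (n+1-β) x) P_n + x (1-x) P_n'`
(`splinePoly_recurrence`). At a root `r < 0` of `P_n` only `r (1-r) P_n'(r)` survives, so `P_{n+1}`
alternates in sign along the roots of `P_n`. With `P_{n+1}(0) > 0` and the behaviour at `-∞`, this
yields `n + 1` simple negative roots interlacing the old ones (`HasNegRoots.exists_interlacing`). By
interlacing, the number of roots in `(-1, 0)` grows by 0 or 1 at each step, and the sign of
`P_{n+1}(-1)` decides which (`SplitsAt.step`). That sign comes from `A_n(β) = P_n(-1)`: since
`A_{n+1}' = 2 A_n` on `(0, 1)` and `A_{n+1}` vanishes at `0` or at `1/2` according to parity,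
monotonicity on `[0, 1/2]` propagates the sign, and reflection covers `β > 1/2`. -/

/-! ### B-splines: regularity, recurrence, support, symmetry. -/

theorem bSpline_one_of_mem {x : ℝ} (h0 : 0 ≤ x) (h1 : x < 1) : bSpline 1 x = 1 := by
  simp [bSpline, indicator, h0, h1]

theorem bSpline_one_of_neg {x : ℝ} (h : x < 0) : bSpline 1 x = 0 := by
  simp [bSpline, indicator, h]

theorem bSpline_one_of_one_le {x : ℝ} (h : 1 ≤ x) : bSpline 1 x = 0 := by
  simp [bSpline, indicator, h]

theorem bSpline_succ_eq_integral (m : ℕ) (x : ℝ) :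
    bSpline (m + 2) x = ∫ s in (x - 1)..x, bSpline (m + 1) s := by
  have h : ∀ t : ℝ, bSpline (m + 1) (x - t) * bSpline 1 t
      = (Ico (0 : ℝ) 1).indicator (fun t => bSpline (m + 1) (x - t)) t := by
    intro t
    by_cases ht : t ∈ Ico (0 : ℝ) 1
    · simp [indicator_of_mem ht, bSpline_one_of_mem ht.1 ht.2]
    · simp [bSpline, indicator_of_notMem ht]
  have h2 := intervalIntegral.integral_comp_sub_left (a := 0) (b := 1)
    (fun s => bSpline (m + 1) s) x
  rw [sub_zero] at h2
  rw [bSpline, ← h2, intervalIntegral.integral_of_le zero_le_one]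
  simp only [h]
  rw [integral_indicator measurableSet_Ico, integral_Ico_eq_integral_Ioo,
    integral_Ioc_eq_integral_Ioo]

theorem bSpline_intervalIntegrable (m : ℕ) :
    (∀ a b : ℝ, IntervalIntegrable (bSpline (m + 1)) volume a b) := by
  induction m with
  | zero =>
    intro a b
    refine Integrable.intervalIntegrable ?_
    rw [zero_add, bSpline]
    exact (integrable_indicator_iff measurableSet_Ico).2
      (integrableOn_const (by simp))
  | succ m ih =>
    intro a b
    refine Continuous.intervalIntegrable ?_ a b
    have : bSpline (m + 1 + 1) = fun x => (∫ s in (0 : ℝ)..x, bSpline (m + 1) s)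
        - ∫ s in (0 : ℝ)..(x - 1), bSpline (m + 1) s := by
      ext x
      rw [bSpline_succ_eq_integral,
        intervalIntegral.integral_interval_sub_left (ih _ _) (ih _ _)]
    rw [this]
    have hc := intervalIntegral.continuous_primitive ih 0
    exact hc.sub (hc.comp (continuous_id.sub continuous_const))

theorem bSpline_succ_eq_sub (m : ℕ) :
    bSpline (m + 2) = fun x => (∫ s in (0 : ℝ)..x, bSpline (m + 1) s)
      - ∫ s in (0 : ℝ)..(x - 1), bSpline (m + 1) s := by
  have ih := bSpline_intervalIntegrable m
  ext x
  rw [bSpline_succ_eq_integral, intervalIntegral.integral_interval_sub_left (ih _ _) (ih _ _)]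

theorem continuous_bSpline (m : ℕ) : Continuous (bSpline (m + 2)) := by
  rw [bSpline_succ_eq_sub]
  have hc := intervalIntegral.continuous_primitive (bSpline_intervalIntegrable m) 0
  exact hc.sub (hc.comp (continuous_id.sub continuous_const))

theorem continuousAt_bSpline_one {x : ℝ} (h0 : x ≠ 0) (h1 : x ≠ 1) :
    ContinuousAt (bSpline 1) x := by
  rcases lt_or_gt_of_ne h0 with h | h
  · refine (continuousAt_const (y := (0 : ℝ))).congr ?_
    filter_upwards [Iio_mem_nhds h] with y hy
    exact (bSpline_one_of_neg hy).symm
  rcases lt_or_gt_of_ne h1 with h' | h'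
  · refine (continuousAt_const (y := (1 : ℝ))).congr ?_
    filter_upwards [Ioo_mem_nhds h h'] with y hy
    exact (bSpline_one_of_mem hy.1.le hy.2).symm
  · refine (continuousAt_const (y := (0 : ℝ))).congr ?_
    filter_upwards [Ioi_mem_nhds h'] with y hy
    exact (bSpline_one_of_one_le (le_of_lt hy)).symm

theorem continuousWithinAt_bSpline (m : ℕ) (x : ℝ) :
    ContinuousWithinAt (bSpline (m + 1)) (Ici x) x := by
  cases m with
  | succ m => exact (continuous_bSpline m).continuousWithinAt
  | zero =>
    rcases lt_or_ge x 0 with h | h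
    · exact (continuousAt_bSpline_one h.ne (by linarith)).continuousWithinAt
    rcases lt_or_ge x 1 with h' | h'
    · refine (continuousWithinAt_const (b := (1 : ℝ))).congr_of_eventuallyEq ?_
        (bSpline_one_of_mem h h')
      filter_upwards [self_mem_nhdsWithin, mem_nhdsWithin_of_mem_nhds (Iio_mem_nhds h')] with y a b
      exact bSpline_one_of_mem (h.trans a) b
    · refine (continuousWithinAt_const (b := (0 : ℝ))).congr_of_eventuallyEq ?_
        (bSpline_one_of_one_le h')
      filter_upwards [self_mem_nhdsWithin] with y a
      exact bSpline_one_of_one_le (h'.trans a)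

theorem stronglyMeasurable_bSpline (m : ℕ) : StronglyMeasurable (bSpline (m + 1)) := by
  cases m with
  | succ m => exact (continuous_bSpline m).stronglyMeasurable
  | zero =>
    rw [zero_add, bSpline]
    exact stronglyMeasurable_const.indicator measurableSet_Ico

theorem hasDerivAt_bSpline {m : ℕ} {x : ℝ} (h : ContinuousAt (bSpline (m + 1)) x)
    (h' : ContinuousAt (bSpline (m + 1)) (x - 1)) :
    HasDerivAt (bSpline (m + 2)) (bSpline (m + 1) x - bSpline (m + 1) (x - 1)) x := by
  rw [bSpline_succ_eq_sub]
  have ih := bSpline_intervalIntegrable m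
  have hm := (stronglyMeasurable_bSpline m)
  refine (intervalIntegral.integral_hasDerivAt_right (ih _ _)
    hm.stronglyMeasurableAtFilter h).sub ?_
  exact (intervalIntegral.integral_hasDerivAt_right (ih _ _)
    hm.stronglyMeasurableAtFilter h').comp_sub_const x 1

/-- Right-continuity of `Q_1` gives a right derivative at every point, knots included, which is
enough to prove identities by differentiation without excluding the jumps. -/
theorem hasDerivWithinAt_bSpline (m : ℕ) (x : ℝ) :
    HasDerivWithinAt (bSpline (m + 2)) (bSpline (m + 1) x - bSpline (m + 1) (x - 1)) (Ici x) x := by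
  rw [bSpline_succ_eq_sub]
  have ih := bSpline_intervalIntegrable m
  have hm := (stronglyMeasurable_bSpline m)
  have key : ∀ y, HasDerivWithinAt (fun u => ∫ s in (0 : ℝ)..u, bSpline (m + 1) s)
      (bSpline (m + 1) y) (Ici y) y := fun y =>
    intervalIntegral.integral_hasDerivWithinAt_right (ih _ _)
      hm.stronglyMeasurableAtFilter
      ((continuousWithinAt_bSpline m y).mono Ioi_subset_Ici_self)
  refine (key x).sub ?_
  have := (key (x - 1)).scomp x ((hasDerivWithinAt_id x (Ici x)).sub_const 1)
    (fun y hy => by simpa using hy)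
  simpa [Function.comp_def] using this

theorem bSpline_of_neg (m : ℕ) : ∀ {x : ℝ}, x < 0 → bSpline (m + 1) x = 0 := by
  induction m with
  | zero => exact fun h => bSpline_one_of_neg h
  | succ m ih =>
    intro x hx
    rw [bSpline_succ_eq_integral]
    refine intervalIntegral.integral_zero_ae (Filter.Eventually.of_forall fun s hs => ih ?_)
    rw [uIoc_of_le (by linarith)] at hs
    linarith [hs.2]

theorem bSpline_succ_of_nonpos (m : ℕ) {x : ℝ} (hx : x ≤ 0) : bSpline (m + 2) x = 0 := by
  rcases hx.lt_or_eq with h | rfl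
  · exact bSpline_of_neg _ h
  · have h0 : (0 : ℝ) ∈ closure (Iio 0) := by simp
    have hcl : IsClosed {x | bSpline (m + 2) x = 0} :=
      isClosed_eq (continuous_bSpline m) continuous_const
    exact hcl.closure_subset_iff.2 (fun y hy => bSpline_of_neg (m + 1) hy) h0

theorem bSpline_two (x : ℝ) : bSpline 2 x = x * bSpline 1 x + (2 - x) * bSpline 1 (x - 1) := by
  have key : ∀ {y : ℝ}, (∫ s in (0 : ℝ)..y, bSpline 1 s) = max 0 (min y 1) := by
    intro y
    have ih := bSpline_intervalIntegrable 0
    have h1 : ∀ z : ℝ, 0 ≤ z → z ≤ 1 → (∫ s in (0 : ℝ)..z, bSpline 1 s) = z := by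
      intro z h0 h1
      have : (∫ s in (0 : ℝ)..z, bSpline 1 s) = ∫ s in (0 : ℝ)..z, (1 : ℝ) := by
        rw [intervalIntegral.integral_of_le h0, intervalIntegral.integral_of_le h0,
          integral_Ioc_eq_integral_Ioo, integral_Ioc_eq_integral_Ioo]
        exact setIntegral_congr_fun measurableSet_Ioo
          fun s hs => bSpline_one_of_mem hs.1.le (hs.2.trans_le h1)
      simp [this]
    rcases lt_or_ge y 0 with h | h
    · rw [intervalIntegral.integral_symm, intervalIntegral.integral_of_le h.le,
        integral_Ioc_eq_integral_Ioo,
        setIntegral_congr_fun measurableSet_Ioo fun s hs => bSpline_one_of_neg hs.2]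
      simp [h.le]
    rcases le_total y 1 with h' | h'
    · rw [h1 y h h', min_eq_left h', max_eq_right h]
    · rw [← intervalIntegral.integral_add_adjacent_intervals (ih 0 1) (ih 1 y), h1 1 (by simp) le_rfl,
        intervalIntegral.integral_of_le h',
        setIntegral_congr_fun measurableSet_Ioc fun s hs => bSpline_one_of_one_le hs.1.le]
      simp [h']
  rw [bSpline_succ_eq_sub]
  simp only [zero_add, key]
  rcases lt_or_ge x 0 with h | h
  · rw [bSpline_one_of_neg h, bSpline_one_of_neg (by linarith), min_eq_left (by linarith),
      min_eq_left (by linarith), max_eq_left (by linarith), max_eq_left (by linarith)]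
    ring
  rcases lt_or_ge x 1 with h' | h'
  · rw [bSpline_one_of_mem h h', bSpline_one_of_neg (by linarith), min_eq_left (by linarith),
      min_eq_left (by linarith), max_eq_right (by linarith), max_eq_left (by linarith)]
    ring
  rcases lt_or_ge x 2 with h2 | h2
  · rw [bSpline_one_of_one_le h', bSpline_one_of_mem (by linarith) (by linarith),
      min_eq_right (by linarith),
      min_eq_left (by linarith), max_eq_right (by linarith), max_eq_right (by linarith)]
    ring
  · rw [bSpline_one_of_one_le h', bSpline_one_of_one_le (by linarith),
      min_eq_right (by linarith),
      min_eq_right (by linarith), max_eq_right (by linarith)]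
    ring

/-- The three-term recurrence of B-splines. -/
theorem bSpline_recurrence (m : ℕ) (x : ℝ) :
    (m + 1) * bSpline (m + 2) x
      = x * bSpline (m + 1) x + (m + 2 - x) * bSpline (m + 1) (x - 1) := by
  induction m generalizing x with
  | zero => simpa using bSpline_two x
  | succ m ih =>
    rcases lt_or_ge x 0 with h | h
    · rw [bSpline_of_neg _ h, bSpline_of_neg _ h, bSpline_of_neg _ (by linarith)]
      ring
    -- The right derivative of this defect is the induction hypothesis at `y` minus that at `y - 1`,
    -- so `f` is constant; it vanishes left of the support.
    let f : ℝ → ℝ := fun x => (m + 2) * bSpline (m + 3) x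
      - (x * bSpline (m + 2) x + (m + 3 - x) * bSpline (m + 2) (x - 1))
    have hcont : Continuous f := by
      have h1 := continuous_bSpline m
      have h2 := continuous_bSpline (m + 1)
      fun_prop
    have hderiv : ∀ y, HasDerivWithinAt f 0 (Ici y) y := by
      intro y
      have h1 := hasDerivWithinAt_bSpline m y
      have h3 := hasDerivWithinAt_bSpline (m + 1) y
      have h2 := (hasDerivWithinAt_bSpline m (y - 1)).scomp y
        ((hasDerivWithinAt_id y (Ici y)).sub_const 1) (fun z hz => by simpa using hz)
      have hid := hasDerivWithinAt_id y (Ici y)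
      have := (h3.const_mul ((m : ℝ) + 2)).sub
        ((hid.mul h1).add ((hid.const_sub ((m : ℝ) + 3)).mul h2))
      refine this.congr_deriv ?_
      have e1 := ih y
      have e2 := ih (y - 1)
      simp only [id, Function.comp_def, smul_eq_mul]
      linear_combination e1 - e2
    have := constant_of_has_deriv_right_zero (a := -1) (b := x) hcont.continuousOn
      (fun y _ => hderiv y) x ⟨by linarith, le_rfl⟩
    have h0 : f (-1) = 0 := by
      simp only [f]
      rw [bSpline_of_neg (m + 2) (by norm_num), bSpline_of_neg (m + 1) (by norm_num),
        bSpline_of_neg (m + 1) (by norm_num)]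
      ring
    rw [h0] at this
    simp only [f] at this
    push_cast
    linear_combination this

theorem bSpline_of_le (m : ℕ) : ∀ {x : ℝ}, (m + 1 : ℝ) ≤ x → bSpline (m + 1) x = 0 := by
  induction m with
  | zero => exact fun h => bSpline_one_of_one_le (by simpa using h)
  | succ m ih =>
    intro x hx
    push_cast at hx
    have h := bSpline_recurrence m x
    rw [ih (by linarith), ih (by linarith)] at h
    have : (m + 1 : ℝ) ≠ 0 := by positivity
    simpa [this] using h

theorem bSpline_nonneg (m : ℕ) (x : ℝ) : 0 ≤ bSpline (m + 1) x := by
  induction m generalizing x with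
  | zero => rw [zero_add, bSpline]; exact indicator_nonneg (fun _ _ => zero_le_one) x
  | succ m ih =>
    rw [bSpline_succ_eq_integral]
    exact intervalIntegral.integral_nonneg (by linarith) fun s _ => ih s

theorem bSpline_pos (m : ℕ) : ∀ {x : ℝ}, 0 < x → x < m + 1 → 0 < bSpline (m + 1) x := by
  induction m with
  | zero =>
    intro x h0 h1
    rw [bSpline_one_of_mem h0.le (by simpa using h1)]
    exact one_pos
  | succ m ih =>
    intro x h0 h1
    push_cast at h1
    have h := bSpline_recurrence m x
    have hm : (0 : ℝ) < m + 1 := by positivity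
    refine pos_of_mul_pos_right (a := (m + 1 : ℝ)) ?_ hm.le
    rw [h]
    rcases lt_or_ge x (m + 1) with h' | h'
    · have := mul_pos h0 (ih h0 h')
      have := mul_nonneg (by linarith : (0 : ℝ) ≤ m + 2 - x) (bSpline_nonneg m (x - 1))
      linarith
    · rcases h'.eq_or_lt with rfl | h''
      -- At the knot `x = m + 1` the second term carries positivity. For `m = 0` its argument is the
      -- endpoint `0`, outside the open interval of the induction hypothesis, but `Q_1(0) = 1`.
      · rcases m with _ | m
        · norm_num [bSpline_one_of_mem, bSpline_one_of_one_le]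
        · have := mul_pos (by linarith : (0 : ℝ) < (m + 1 : ℕ) + 2 - ((m + 1 : ℕ) + 1))
            (ih (x := ((m + 1 : ℕ) + 1 : ℝ) - 1) (by push_cast; linarith [(m.cast_nonneg : (0:ℝ) ≤ m)])
              (by linarith))
          have := mul_nonneg h0.le (bSpline_nonneg (m + 1) ((m + 1 : ℕ) + 1))
          linarith
      · have := mul_pos (by linarith : (0 : ℝ) < m + 2 - x)
          (ih (x := x - 1) (by linarith [(m.cast_nonneg : (0:ℝ) ≤ m)]) (by linarith))
        have := mul_nonneg h0.le (bSpline_nonneg m x)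
        linarith

theorem bSpline_symm (m : ℕ) (x : ℝ) : bSpline (m + 2) (m + 2 - x) = bSpline (m + 2) x := by
  induction m generalizing x with
  | zero =>
    simp only [Nat.cast_zero, zero_add]
    rw [bSpline_two, bSpline_two]
    -- `Q_1` fails to be symmetric only at `0` and `1`; the factor `y` removes the failure at `0`.
    have hne : ∀ y : ℝ, y * bSpline 1 y = y * bSpline 1 (1 - y)
        ∨ y = 1 := by
      intro y
      by_cases h1 : y = 1
      · exact Or.inr h1
      left
      rcases lt_trichotomy y 0 with h | h | h
      · rw [bSpline_one_of_neg h, bSpline_one_of_one_le (by linarith)]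
      · simp [h]
      rcases lt_or_gt_of_ne h1 with h' | h'
      · rw [bSpline_one_of_mem h.le h', bSpline_one_of_mem (by linarith) (by linarith)]
      · rw [bSpline_one_of_one_le h'.le, bSpline_one_of_neg (by linarith)]
    rcases hne x with h | rfl
    · rcases hne (2 - x) with h' | h'
      · rw [show 1 - (2 - x) = x - 1 by ring] at h'
        rw [show 2 - x - 1 = 1 - x by ring, h, h']
        ring
      · have : x = 1 := by linarith
        subst this
        norm_num
    · norm_num
  | succ m ih =>
    have h1 := bSpline_recurrence (m + 1) x
    have h2 := bSpline_recurrence (m + 1) ((m + 1 : ℕ) + 2 - x)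
    have e1 := ih x
    have e2 := ih (x - 1)
    have hm : ((m + 1 : ℕ) + 1 : ℝ) ≠ 0 := by positivity
    apply mul_left_cancel₀ hm
    rw [h1, h2]
    push_cast
    rw [show (m : ℝ) + 1 + 2 - x - 1 = m + 2 - x by ring, e1,
      show (m : ℝ) + 1 + 2 - x = m + 2 - (x - 1) by ring, e2]
    ring

/-! ### Simple negative roots, interlacing, and the position of `-1`. -/

theorem neg_one_pow_mul_prod_pos {S : Finset ℕ} {f : ℕ → ℝ} {k : ℕ}
    (hneg : ∀ i ∈ S, i < k → f i < 0) (hpos : ∀ i ∈ S, k ≤ i → 0 < f i) :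
    0 < (-1) ^ (S.filter (· < k)).card * ∏ i ∈ S, f i := by
  induction S using Finset.induction_on with
  | empty => simp
  | insert a S ha ih =>
    have := ih (fun i hi => hneg i (by simp [hi])) (fun i hi => hpos i (by simp [hi]))
    rw [Finset.prod_insert ha, Finset.filter_insert]
    split_ifs with h
    · rw [Finset.card_insert_of_notMem (by simp [ha]), pow_succ]
      nlinarith [hneg a (by simp) h]
    · nlinarith [hpos a (by simp) (not_lt.1 h)]

/-- `p` has exactly the `n` simple roots `r 0 > r 1 > ⋯ > r (n - 1)`, all negative, and a positive
leading coefficient. -/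
structure HasNegRoots (p : ℝ[X]) (n : ℕ) (r : ℕ → ℝ) : Prop where
  eq_prod : p = C p.leadingCoeff * ∏ i ∈ Finset.range n, (X - C (r i))
  leadingCoeff_pos : 0 < p.leadingCoeff
  lt : ∀ i j, i < j → j < n → r j < r i
  neg : ∀ i < n, r i < 0

namespace HasNegRoots

variable {p : ℝ[X]} {n : ℕ} {r : ℕ → ℝ}

theorem eval_eq (h : HasNegRoots p n r) (x : ℝ) :
    p.eval x = p.leadingCoeff * ∏ i ∈ Finset.range n, (x - r i) := by
  conv_lhs => rw [h.eq_prod]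
  simp [eval_prod]

theorem sign_eval (h : HasNegRoots p n r) {x : ℝ} {k : ℕ} (hk : k ≤ n)
    (hlt : ∀ i < k, x < r i) (hgt : ∀ i < n, k ≤ i → r i < x) : 0 < (-1) ^ k * p.eval x := by
  have := neg_one_pow_mul_prod_pos (S := Finset.range n) (f := fun i => x - r i) (k := k)
    (fun i _ hi' => by linarith [hlt i hi'])
    (fun i hi hi' => by linarith [hgt i (Finset.mem_range.1 hi) hi'])
  rw [show (Finset.range n).filter (· < k) = Finset.range k by ext; simp; omega,
    Finset.card_range] at this
  rw [h.eval_eq, mul_left_comm]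
  exact mul_pos h.leadingCoeff_pos this

theorem eval_root (h : HasNegRoots p n r) {i : ℕ} (hi : i < n) : p.eval (r i) = 0 := by
  rw [h.eval_eq, Finset.prod_eq_zero (Finset.mem_range.2 hi) (sub_self _), mul_zero]

theorem sign_eval_derivative (h : HasNegRoots p n r) {i : ℕ} (hi : i < n) :
    0 < (-1) ^ i * p.derivative.eval (r i) := by
  have := neg_one_pow_mul_prod_pos (S := (Finset.range n).erase i) (f := fun j => r i - r j) (k := i)
    (fun j _ hj' => by linarith [h.lt j i hj' hi])
    (fun j hj hj' => by
      simp only [Finset.mem_erase, Finset.mem_range] at hj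
      linarith [h.lt i j (by omega) hj.2])
  rw [show ((Finset.range n).erase i).filter (· < i) = Finset.range i by ext; simp; omega,
    Finset.card_range] at this
  rw [h.eq_prod, ← Finset.mul_prod_erase _ _ (Finset.mem_range.2 hi)]
  simp only [derivative_mul, derivative_C, derivative_X_sub_C, eval_add, eval_mul, eval_C,
    eval_sub, eval_X, sub_self, zero_mul, add_zero, zero_add, eval_prod, one_mul]
  rw [mul_left_comm]
  exact mul_pos h.leadingCoeff_pos this

end HasNegRoots

theorem exists_lt_sign_eval {q : ℝ[X]} {n : ℕ} (hn : 0 < n) (hdeg : q.natDegree = n)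
    (hlc : 0 < q.leadingCoeff) (M : ℝ) : ∃ x < M, 0 < (-1) ^ n * q.eval x := by
  have hlc' : (C ((-1 : ℝ) ^ n) * q.comp (-X)).leadingCoeff = q.leadingCoeff := by
    rw [leadingCoeff_mul, leadingCoeff_C, leadingCoeff_comp (by simp), hdeg]
    simp only [leadingCoeff_neg, leadingCoeff_X]
    rw [mul_left_comm, ← mul_pow]
    simp
  have hd : 0 < (C ((-1 : ℝ) ^ n) * q.comp (-X)).degree := by
    rw [← natDegree_pos_iff_degree_pos, natDegree_C_mul (by simp), natDegree_comp, hdeg]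
    simpa using hn
  have := tendsto_atTop_of_leadingCoeff_nonneg _ hd (by rw [hlc']; exact hlc.le)
  obtain ⟨x, hx, hxM⟩ := ((this.eventually_gt_atTop 0).and
    (Filter.eventually_gt_atTop (-M))).exists
  exact ⟨-x, by linarith, by simpa using hx⟩

theorem exists_root_of_sign {q : ℝ[X]} {a b : ℝ} (hab : a < b) {i : ℕ}
    (hb : 0 < (-1) ^ i * q.eval b) (ha : 0 < (-1) ^ (i + 1) * q.eval a) :
    ∃ x, a < x ∧ x < b ∧ q.eval x = 0 := by
  have hc : ContinuousOn (fun x => (-1) ^ i * q.eval x) (Icc a b) :=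
    (continuous_const.mul q.continuous).continuousOn
  rw [pow_succ] at ha
  obtain ⟨x, hx, hx'⟩ := intermediate_value_Ioo hab.le hc ⟨by linarith, hb⟩
  exact ⟨x, hx.1, hx.2, by simpa using hx'⟩

theorem eq_prod_of_roots {q : ℝ[X]} {n : ℕ} {t : ℕ → ℝ} (hdeg : q.natDegree = n) (hq : q ≠ 0)
    (hlt : ∀ i j, i < j → j < n → t j < t i) (hroot : ∀ i < n, q.eval (t i) = 0) :
    q = C q.leadingCoeff * ∏ i ∈ Finset.range n, (X - C (t i)) := by
  have hinj : Set.InjOn t (Finset.range n) := by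
    intro i hi j hj hij
    simp only [Finset.coe_range, Set.mem_Iio] at hi hj
    rcases lt_trichotomy i j with h | h | h
    · linarith [hlt i j h hj]
    · exact h
    · linarith [hlt j i h hi]
  have hsub : ((Finset.range n).image t).val ≤ q.roots := by
    rw [Multiset.le_iff_subset (Finset.nodup _)]
    intro x hx
    simp only [Finset.mem_val, Finset.mem_image, Finset.mem_range] at hx
    obtain ⟨i, hi, rfl⟩ := hx
    exact (mem_roots hq).2 (hroot i hi)
  have hcard : ((Finset.range n).image t).val.card = n := by
    rw [Finset.card_val, Finset.card_image_of_injOn hinj, Finset.card_range]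
  have hroots : ((Finset.range n).image t).val = q.roots :=
    Multiset.eq_of_le_of_card_le hsub (by rw [hcard, ← hdeg]; exact q.card_roots')
  have h := C_leadingCoeff_mul_prod_multiset_X_sub_C (p := q) (by rw [← hroots, hcard, hdeg])
  rw [← hroots] at h
  conv_lhs => rw [← h]
  congr 1
  exact Finset.prod_image (f := fun x => X - C x) hinj

/-- If the values of `q` at `0` and at the roots of `p` alternate in sign, then the roots of `q`
are separated by those of `p`. -/
theorem HasNegRoots.exists_interlacing {p q : ℝ[X]} {n : ℕ} {r : ℕ → ℝ} (h : HasNegRoots p n r)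
    (hdeg : q.natDegree = n + 1) (hlc : 0 < q.leadingCoeff) (h0 : 0 < q.eval 0)
    (hsign : ∀ i < n, 0 < (-1) ^ (i + 1) * q.eval (r i)) :
    ∃ t : ℕ → ℝ, HasNegRoots q (n + 1) t ∧ (∀ i < n, r i < t i) ∧ ∀ i < n, t (i + 1) < r i := by
  obtain ⟨M, hM⟩ : ∃ M : ℝ, M < 0 ∧ ∀ i < n, M < r i := by
    rcases n with _ | n
    · exact ⟨-1, by norm_num, by simp⟩
    · refine ⟨r n - 1, by linarith [h.neg n (by omega)], fun i hi => ?_⟩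
      rcases Nat.lt_succ_iff_lt_or_eq.1 hi with h' | rfl
      · linarith [h.lt i n h' (by omega)]
      · linarith
  obtain ⟨y, hy, hys⟩ := exists_lt_sign_eval n.succ_pos hdeg hlc M
  -- The decreasing grid `0 > r 0 > ⋯ > r (n - 1) > y`, on which `q` has sign `(-1)^i`; each of its
  -- `n + 1` gaps holds a root.
  let a : ℕ → ℝ := fun i => if i = 0 then 0 else if i ≤ n then r (i - 1) else y
  have a0 : a 0 = 0 := rfl
  have har : ∀ i < n, a (i + 1) = r i := by
    intro i hi
    simp [a, show i + 1 ≤ n by omega]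
  have hay : a (n + 1) = y := by simp [a]
  have ha : ∀ i ≤ n, a (i + 1) < a i := by
    intro i hi
    rcases hi.lt_or_eq with hi | rfl
    · rw [har i hi]
      rcases i with _ | i
      · exact h.neg _ hi
      · rw [har i (by omega)]
        exact h.lt _ _ (by omega) hi
    · rw [hay]
      rcases i with _ | i
      · exact hy.trans hM.1
      · rw [har i (by omega)]
        exact hy.trans (hM.2 _ (by omega))
  have has : ∀ i ≤ n + 1, 0 < (-1) ^ i * q.eval (a i) := by
    intro i hi
    rcases i with _ | i
    · simpa [a] using h0
    · rcases (Nat.le_of_succ_le_succ hi).lt_or_eq with hi | rfl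
      · rw [har i hi]
        exact hsign i hi
      · rwa [hay]
  have hex : ∀ i, ∃ x, i ≤ n → a (i + 1) < x ∧ x < a i ∧ q.eval x = 0 := by
    intro i
    by_cases hi : i ≤ n
    · obtain ⟨x, hx⟩ := exists_root_of_sign (ha i hi) (has i (by omega)) (has (i + 1) (by omega))
      exact ⟨x, fun _ => hx⟩
    · exact ⟨0, fun h => absurd h hi⟩
  choose t ht using hex
  have hanti : ∀ i j, i ≤ j → j ≤ n + 1 → a j ≤ a i := by
    intro i j hij
    induction j, hij using Nat.le_induction with
    | base => simp
    | succ j _ ih => intro hj; exact (ha j (by omega)).le.trans (ih (by omega))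
  have hlt : ∀ i j, i < j → j < n + 1 → t j < t i := fun i j hij hj =>
    ((ht j (by omega)).2.1.trans_le (hanti (i + 1) j hij (by omega))).trans (ht i (by omega)).1
  refine ⟨t, ⟨eq_prod_of_roots hdeg (by rintro rfl; simp at hlc) hlt
    fun i hi => (ht i (by omega)).2.2, hlc, hlt, fun i hi => ?_⟩, fun i hi => ?_, fun i hi => ?_⟩
  · have := (ht i (by omega)).2.1.trans_le (hanti 0 i (by omega) (by omega))
    simpa [a] using this
  · rw [← har i hi]
    exact (ht i hi.le).1
  · rw [← har i hi]
    exact (ht (i + 1) hi).2.1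

/-- The roots of index less than `k` lie to the right of `-1`, the others to the left. -/
def SplitsAt (n k : ℕ) (r : ℕ → ℝ) : Prop :=
  k ≤ n ∧ (∀ i < k, -1 < r i) ∧ ∀ i < n, k ≤ i → r i < -1

/-- Interlacing fixes the side of `-1` for every new root except `t k`. The sign of `q` at `-1` is
the parity of the number of roots to its right, which settles that last one. -/
theorem SplitsAt.step {q : ℝ[X]} {n k k' : ℕ} {r t : ℕ → ℝ}
    (hr : SplitsAt n k r) (hq : HasNegRoots q (n + 1) t)
    (hl : ∀ i < n, r i < t i) (hu : ∀ i < n, t (i + 1) < r i)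
    (hk : k' = k ∨ k' = k + 1) (hs : 0 < (-1) ^ k' * q.eval (-1)) : SplitsAt (n + 1) k' t := by
  obtain ⟨hkn, h1, h2⟩ := hr
  have hlow : ∀ i < k, -1 < t i := fun i hi => (h1 i hi).trans (hl i (by omega))
  have hhigh : ∀ i < n + 1, k + 1 ≤ i → t i < -1 := by
    intro i hi hki
    obtain ⟨i, rfl⟩ : ∃ j, i = j + 1 := ⟨i - 1, by omega⟩
    exact (hu i (by omega)).trans (h2 i (by omega) (by omega))
  have hne : t k ≠ -1 := by
    intro h
    rw [← h, hq.eval_root (by omega), mul_zero] at hs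
    exact hs.false
  rcases lt_or_gt_of_ne hne with h | h
  · have hsplit : ∀ i < n + 1, k ≤ i → t i < -1 := fun i hi hki => by
      rcases hki.eq_or_lt with rfl | h'
      · exact h
      · exact hhigh i hi h'
    rcases hk with rfl | rfl
    · exact ⟨by omega, hlow, hsplit⟩
    · have := hq.sign_eval (x := -1) (k := k) (by omega) hlow hsplit
      rw [pow_succ] at hs
      linarith
  · have hsplit : ∀ i < k + 1, -1 < t i := fun i hi => by
      rcases Nat.lt_succ_iff_lt_or_eq.1 hi with h' | rfl
      · exact hlow i h'
      · exact h
    rcases hk with rfl | rfl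
    · have := hq.sign_eval (x := -1) (k := k' + 1) (by omega) hsplit hhigh
      rw [pow_succ] at this
      linarith
    · exact ⟨by omega, hsplit, hhigh⟩

/-! ### The spline polynomial and its differential recurrence. -/

/-- The exponential spline of degree `n` as a polynomial in `t⁻¹`. -/
noncomputable def splinePoly (n : ℕ) (β : ℝ) : ℝ[X] :=
  ∑ j ∈ Finset.range (n + 1), monomial j (bSpline (n + 1) (β + j))

theorem coeff_splinePoly {n : ℕ} {β : ℝ} (hβ : 0 ≤ β) (j : ℕ) :
    (splinePoly n β).coeff j = bSpline (n + 1) (β + j) := by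
  simp only [splinePoly, finsetSum_coeff, coeff_monomial, Finset.sum_ite_eq', Finset.mem_range]
  split_ifs with h
  · rfl
  · have : ((n + 1 : ℕ) : ℝ) ≤ j := by exact_mod_cast not_lt.1 h
    push_cast at this
    rw [bSpline_of_le n (by linarith)]

theorem eval_splinePoly (n : ℕ) (β x : ℝ) :
    (splinePoly n β).eval x = ∑ j ∈ Finset.range (n + 1), bSpline (n + 1) (β + j) * x ^ j := by
  simp [splinePoly, eval_finsetSum]

theorem coeff_splinePoly_pos {n : ℕ} {β : ℝ} (h0 : 0 < β) (h1 : β < 1) {j : ℕ} (hj : j ≤ n) :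
    0 < (splinePoly n β).coeff j := by
  rw [coeff_splinePoly h0.le]
  have : (j : ℝ) ≤ n := by exact_mod_cast hj
  exact bSpline_pos n (by positivity) (by linarith)

theorem natDegree_splinePoly {n : ℕ} {β : ℝ} (h0 : 0 < β) (h1 : β < 1) :
    (splinePoly n β).natDegree = n := by
  refine natDegree_eq_of_le_of_coeff_ne_zero ?_ (coeff_splinePoly_pos h0 h1 le_rfl).ne'
  refine natDegree_sum_le_of_forall_le _ _ fun j hj => ?_
  exact (natDegree_monomial_le _).trans (by simpa [Nat.lt_succ_iff] using hj)

theorem leadingCoeff_splinePoly_pos {n : ℕ} {β : ℝ} (h0 : 0 < β) (h1 : β < 1) :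
    0 < (splinePoly n β).leadingCoeff := by
  rw [leadingCoeff, natDegree_splinePoly h0 h1]
  exact coeff_splinePoly_pos h0 h1 le_rfl

/-- Coefficientwise this is `bSpline_recurrence` at `β + j`: a factor `j` becomes `X * derivative`,
and the shift by one becomes multiplication by `X`. -/
theorem splinePoly_recurrence {n : ℕ} {β : ℝ} (h0 : 0 < β) (h1 : β < 1) :
    C (n + 1 : ℝ) * splinePoly (n + 1) β
      = C β * splinePoly n β + C (n + 1 - β) * (X * splinePoly n β)
        + (X * derivative (splinePoly n β) - X * (X * derivative (splinePoly n β))) := by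
  ext j
  simp only [coeff_add, coeff_sub, coeff_C_mul]
  rw [coeff_splinePoly h0.le, coeff_splinePoly h0.le, bSpline_recurrence]
  rcases j with _ | j
  · simp [bSpline_of_neg n (show β - 1 < 0 by linarith)]
  · rw [coeff_X_mul, coeff_X_mul, coeff_X_mul, coeff_derivative, coeff_splinePoly h0.le,
      coeff_splinePoly h0.le]
    rcases j with _ | j
    · push_cast
      simp
      ring
    · rw [coeff_X_mul, coeff_derivative, coeff_splinePoly h0.le]
      push_cast
      rw [show β + ((j : ℝ) + 1 + 1) - 1 = β + (j + 1) by ring]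
      ring

/-! ### The sign at `-1` as a function of `β`. -/

/-- The value of the exponential spline at `-1`. -/
noncomputable def splineAlt (n : ℕ) (β : ℝ) : ℝ :=
  ∑ j ∈ Finset.range (n + 1), (-1) ^ j * bSpline (n + 1) (β + j)

theorem eval_neg_one_splinePoly (n : ℕ) (β : ℝ) :
    (splinePoly n β).eval (-1) = splineAlt n β := by
  simp [eval_splinePoly, splineAlt, mul_comm]

theorem continuous_splineAlt (n : ℕ) : Continuous (splineAlt (n + 1)) := by
  have := continuous_bSpline n
  unfold splineAlt
  fun_prop

theorem splineAlt_one_sub (n : ℕ) (β : ℝ) :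
    splineAlt (n + 1) (1 - β) = (-1) ^ (n + 1) * splineAlt (n + 1) β := by
  unfold splineAlt
  rw [← Finset.sum_range_reflect, Finset.mul_sum]
  refine Finset.sum_congr rfl fun j hj => ?_
  have hj' : j ≤ n + 1 := by simpa [Nat.lt_succ_iff] using hj
  rw [show n + 1 + 1 - 1 - j = n + 1 - j by omega, Nat.cast_sub hj', ← bSpline_symm n (β + j),
    ← mul_assoc, ← pow_add]
  congr 1
  · rw [show n + 1 + j = n + 1 - j + 2 * j by omega, pow_add, pow_mul]
    simp
  · push_cast
    congr 1
    ring

/-- Moving `β` from `0` to `1` shifts the summation index, flipping every sign; the unmatched end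
terms vanish at the ends of the support. -/
theorem splineAlt_one (n : ℕ) : splineAlt (n + 1) 1 = -splineAlt (n + 1) 0 := by
  unfold splineAlt
  rw [Finset.sum_range_succ, Finset.sum_range_succ' _ (n + 1), bSpline_of_le (n + 1) (by push_cast; linarith),
    bSpline_succ_of_nonpos n (by simp), mul_zero, mul_zero, add_zero, add_zero,
    ← Finset.sum_neg_distrib]
  refine Finset.sum_congr rfl fun j _ => ?_
  push_cast
  rw [zero_add, add_comm (1 : ℝ), pow_succ]
  ring

theorem splineAlt_zero_of_even {n : ℕ} (hn : Even (n + 1)) : splineAlt (n + 1) 0 = 0 := by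
  have h1 := splineAlt_one_sub n 0
  rw [hn.neg_one_pow, sub_zero, splineAlt_one] at h1
  linarith

theorem splineAlt_half_of_odd {n : ℕ} (hn : Odd (n + 1)) : splineAlt (n + 1) (1 / 2) = 0 := by
  have h1 := splineAlt_one_sub n (1 / 2)
  rw [hn.neg_one_pow, show (1 : ℝ) - 1 / 2 = 1 / 2 by norm_num] at h1
  linarith

theorem continuousAt_bSpline_add_int (n : ℕ) {β : ℝ} (h0 : 0 < β) (h1 : β < 1) (j : ℤ) :
    ContinuousAt (bSpline (n + 1)) (β + j) := by
  rcases n with _ | n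
  · refine continuousAt_bSpline_one (fun h => ?_) (fun h => ?_)
    · have a : (-1 : ℝ) < j := by linarith
      have b : (j : ℝ) < 0 := by linarith
      norm_cast at a b
      omega
    · have a : (0 : ℝ) < j := by linarith
      have b : (j : ℝ) < 1 := by linarith
      norm_cast at a b
      omega
  · exact (continuous_bSpline n).continuousAt

/-- Since `Q_{n+2}'(x) = Q_{n+1}(x) - Q_{n+1}(x - 1)`, reindexing the shifted alternating sum turns
the difference into a doubling. Staying inside `(0, 1)` avoids the jumps of `Q_1`. -/
theorem hasDerivAt_splineAlt (n : ℕ) {β : ℝ} (h0 : 0 < β) (h1 : β < 1) :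
    HasDerivAt (splineAlt (n + 1)) (2 * splineAlt n β) β := by
  have key : ∀ j : ℕ, HasDerivAt (fun β : ℝ => (-1) ^ j * bSpline (n + 2) (β + j))
      ((-1) ^ j * (bSpline (n + 1) (β + j) - bSpline (n + 1) (β + j - 1))) β := by
    intro j
    have e1 := continuousAt_bSpline_add_int n h0 h1 j
    have e2 := continuousAt_bSpline_add_int n h0 h1 (j - 1)
    push_cast at e1 e2
    rw [← add_sub_assoc] at e2
    exact ((hasDerivAt_bSpline e1 e2).comp_add_const β (j : ℝ)).const_mul _
  have := HasDerivAt.fun_sum (u := Finset.range (n + 2)) fun j _ => key j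
  refine this.congr_deriv ?_
  simp only [mul_sub, Finset.sum_sub_distrib]
  rw [Finset.sum_range_succ, Finset.sum_range_succ' _ (n + 1),
    bSpline_of_le n (by push_cast; linarith), bSpline_of_neg n (x := β + (0 : ℕ) - 1) (by simpa using h1)]
  unfold splineAlt
  have : ∀ j : ℕ, (-1 : ℝ) ^ (j + 1) * bSpline (n + 1) (β + ((j + 1 : ℕ) : ℝ) - 1)
      = -((-1) ^ j * bSpline (n + 1) (β + j)) := by
    intro j
    push_cast
    rw [← add_assoc, add_sub_cancel_right, pow_succ]
    ring
  simp only [this, Finset.sum_neg_distrib]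
  ring

theorem sign_splineAlt_left (n : ℕ) : ∀ {β : ℝ}, 0 < β → β < 1 / 2 →
    0 < (-1) ^ ((n + 1) / 2) * splineAlt n β := by
  induction n with
  | zero =>
    intro β h0 h1
    have : bSpline 1 β = 1 := bSpline_one_of_mem h0.le (by linarith)
    simp [splineAlt, this]
  | succ n ih =>
    intro β h0 h1
    have hmono : StrictMonoOn (fun β => (-1) ^ ((n + 1) / 2) * splineAlt (n + 1) β)
        (Icc (0 : ℝ) (1 / 2)) := by
      refine strictMonoOn_of_deriv_pos (convex_Icc _ _)
        (continuous_const.mul (continuous_splineAlt n)).continuousOn fun x hx => ?_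
      rw [interior_Icc] at hx
      rw [((hasDerivAt_splineAlt n hx.1 (by linarith [hx.2])).const_mul _).deriv]
      linarith [ih hx.1 hx.2]
    -- If `n + 1` is even the zero is at `0` and the sign persists; if odd it is at `1/2`, the
    -- increasing function is negative before it, and the exponent goes up by one.
    rcases Nat.even_or_odd (n + 1) with hn | hn
    · have := hmono (left_mem_Icc.2 (by norm_num)) ⟨h0.le, h1.le⟩ h0
      simp only [splineAlt_zero_of_even hn, mul_zero] at this
      rwa [show (n + 1 + 1) / 2 = (n + 1) / 2 by obtain ⟨k, hk⟩ := hn; omega]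
    · have := hmono ⟨h0.le, h1.le⟩ (right_mem_Icc.2 (by norm_num)) h1
      simp only [splineAlt_half_of_odd hn, mul_zero] at this
      rw [show (n + 1 + 1) / 2 = (n + 1) / 2 + 1 by obtain ⟨k, hk⟩ := hn; omega, pow_succ]
      linarith

theorem sign_splineAlt_right (n : ℕ) {β : ℝ} (h0 : 1 / 2 < β) (h1 : β < 1) :
    0 < (-1) ^ (n / 2) * splineAlt n β := by
  rcases n with _ | n
  · have : bSpline 1 β = 1 := bSpline_one_of_mem (by linarith) h1
    simp [splineAlt, this]
  · have h := sign_splineAlt_left (n + 1) (β := 1 - β) (by linarith) (by linarith)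
    rw [splineAlt_one_sub, ← mul_assoc, ← pow_add] at h
    convert h using 2
    rcases Nat.even_or_odd' (n + 1) with ⟨k, hk | hk⟩
    · rw [hk, show (2 * k) / 2 = k by omega, show (2 * k + 1) / 2 + 2 * k = k + 2 * k by omega,
        pow_add _ k, pow_mul]
      simp
    · rw [hk, show (2 * k + 1) / 2 = k by omega,
        show (2 * k + 1 + 1) / 2 + (2 * k + 1) = k + 2 * (k + 1) by omega, pow_add _ k, pow_mul]
      simp

/-! ### Roots of the spline polynomial by induction on the degree. -/

theorem exists_step_splinePoly {n : ℕ} {β : ℝ} (h0 : 0 < β) (h1 : β < 1) {r : ℕ → ℝ}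
    (h : HasNegRoots (splinePoly n β) n r) :
    ∃ t : ℕ → ℝ, HasNegRoots (splinePoly (n + 1) β) (n + 1) t ∧
      (∀ i < n, r i < t i) ∧ ∀ i < n, t (i + 1) < r i := by
  refine h.exists_interlacing (natDegree_splinePoly h0 h1) (leadingCoeff_splinePoly_pos h0 h1) ?_ ?_
  · rw [← coeff_zero_eq_eval_zero]
    exact coeff_splinePoly_pos h0 h1 (Nat.zero_le _)
  · intro i hi
    have hrec := congrArg (eval (r i)) (splinePoly_recurrence (n := n) h0 h1)
    simp only [eval_add, eval_mul, eval_sub, eval_C, eval_X, h.eval_root hi] at hrec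
    have hd := h.sign_eval_derivative hi
    have hr := h.neg i hi
    have hn : (0 : ℝ) < n + 1 := by positivity
    refine pos_of_mul_pos_right (a := (n + 1 : ℝ)) ?_ hn.le
    rw [mul_left_comm, hrec, pow_succ]
    -- At a root of `P_n` the recurrence leaves `r (1 - r) P_n'(r)`; this factor is negative, so the
    -- alternating sign of `P_n'` is reversed.
    have : 0 < (-r i) * (1 - r i) := mul_pos (by linarith) (by linarith)
    have := mul_pos this hd
    linarith

theorem hasNegRoots_splinePoly_zero {β : ℝ} (h0 : 0 < β) (h1 : β < 1) :
    HasNegRoots (splinePoly 0 β) 0 0 where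
  eq_prod := by
    simpa using eq_C_of_natDegree_eq_zero (natDegree_splinePoly (n := 0) h0 h1)
      |>.trans (by rw [leadingCoeff, natDegree_splinePoly h0 h1])
  leadingCoeff_pos := leadingCoeff_splinePoly_pos h0 h1
  lt := by simp
  neg := by simp

theorem exists_hasNegRoots_splinePoly (n : ℕ) {β : ℝ} (h0 : 0 < β) (h1 : β < 1) :
    ∃ r : ℕ → ℝ, HasNegRoots (splinePoly n β) n r := by
  induction n with
  | zero => exact ⟨0, hasNegRoots_splinePoly_zero h0 h1⟩
  | succ n ih =>
    obtain ⟨r, hr⟩ := ih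
    obtain ⟨t, ht, -⟩ := exists_step_splinePoly h0 h1 hr
    exact ⟨t, ht⟩

theorem exists_splitsAt_splinePoly {β : ℝ} (h0 : 0 < β) (h1 : β < 1) {k : ℕ → ℕ} (hk0 : k 0 = 0)
    (hk : ∀ n, k (n + 1) = k n ∨ k (n + 1) = k n + 1)
    (hs : ∀ n, 0 < (-1) ^ k n * splineAlt n β) (n : ℕ) :
    ∃ r : ℕ → ℝ, HasNegRoots (splinePoly n β) n r ∧ SplitsAt n (k n) r := by
  induction n with
  | zero => exact ⟨0, hasNegRoots_splinePoly_zero h0 h1, by simp [SplitsAt, hk0]⟩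
  | succ n ih =>
    obtain ⟨r, hr, hsplit⟩ := ih
    obtain ⟨t, ht, hl, hu⟩ := exists_step_splinePoly h0 h1 hr
    exact ⟨t, ht, hsplit.step ht hl hu (hk n) (by rw [eval_neg_one_splinePoly]; exact hs _)⟩

/-! ### Transfer to the zeros in `t` through `t = 1/r`. -/

theorem exponentialSpline_eq_eval {n : ℕ} {β : ℝ} (h1 : β < 1) (h0 : 0 < β) (t : ℂ) :
    exponentialSpline n β t = ((splinePoly n β).map (algebraMap ℝ ℂ)).eval t⁻¹ := by
  unfold exponentialSpline
  have hinj : Function.Injective (fun j : ℕ => -(j : ℤ)) := fun a b h => by simpa using h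
  rw [tsum_eq_sum (s := (Finset.range (n + 1)).image fun j : ℕ => -(j : ℤ))]
  · rw [Finset.sum_image hinj.injOn]
    simp [splinePoly, Polynomial.map_sum, eval_finsetSum, mul_comm]
  · intro k hk
    rw [mul_eq_zero, Complex.ofReal_eq_zero]
    right
    rcases lt_or_ge 0 k with h | h
    · refine bSpline_of_neg n ?_
      have : (1 : ℝ) ≤ k := by exact_mod_cast h
      linarith
    · obtain ⟨j, rfl⟩ : ∃ j : ℕ, k = -(j : ℤ) := ⟨k.natAbs, by omega⟩
      have hj : n + 1 ≤ j := by
        by_contra hj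
        exact hk (Finset.mem_image_of_mem _ (Finset.mem_range.2 (by omega)))
      have : ((n + 1 : ℕ) : ℝ) ≤ j := by exact_mod_cast hj
      refine bSpline_of_le n ?_
      push_cast at this ⊢
      linarith

theorem HasNegRoots.eval_map {p : ℝ[X]} {n : ℕ} {r : ℕ → ℝ} (h : HasNegRoots p n r) (z : ℂ) :
    (p.map (algebraMap ℝ ℂ)).eval z
      = p.leadingCoeff * ∏ i ∈ Finset.range n, (z - r i) := by
  conv_lhs => rw [h.eq_prod]
  simp [eval_prod, Polynomial.map_prod]

theorem HasNegRoots.mem_exponentialSplineZeros {n : ℕ} {β : ℝ} {r : ℕ → ℝ} (h0 : 0 < β)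
    (h1 : β < 1) (h : HasNegRoots (splinePoly n β) n r) (t : ℂ) :
    t ∈ exponentialSplineZeros n β ↔ ∃ i < n, t = (((r i)⁻¹ : ℝ) : ℂ) := by
  simp only [exponentialSplineZeros, mem_ofPred_eq, exponentialSpline_eq_eval h1 h0, h.eval_map,
    mul_eq_zero, Complex.ofReal_eq_zero, h.leadingCoeff_pos.ne', false_or, Finset.prod_eq_zero_iff,
    Finset.mem_range, sub_eq_zero, Complex.ofReal_inv]
  constructor
  · rintro ⟨-, i, hi, hti⟩
    exact ⟨i, hi, by rw [← hti, inv_inv]⟩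
  · rintro ⟨i, hi, rfl⟩
    exact ⟨inv_ne_zero (by exact_mod_cast (h.neg i hi).ne), i, hi, by rw [inv_inv]⟩

theorem HasNegRoots.analyticOrderAt_eq_one {n : ℕ} {β : ℝ} {r : ℕ → ℝ} (h0 : 0 < β)
    (h1 : β < 1) (h : HasNegRoots (splinePoly n β) n r) {i : ℕ} (hi : i < n) :
    analyticOrderAt (exponentialSpline n β) (((r i)⁻¹ : ℝ) : ℂ) = 1 := by
  have hne : ((r i : ℝ) : ℂ) ≠ 0 := by exact_mod_cast (h.neg i hi).ne
  have hne' : (((r i)⁻¹ : ℝ) : ℂ) ≠ 0 := by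
    rw [Complex.ofReal_inv]
    exact inv_ne_zero hne
  have hfun : exponentialSpline n β
      = fun t => ((splinePoly n β).map (algebraMap ℝ ℂ)).eval t⁻¹ :=
    funext (exponentialSpline_eq_eval h1 h0)
  have han : AnalyticAt ℂ (exponentialSpline n β) (((r i)⁻¹ : ℝ) : ℂ) := by
    rw [hfun]
    have := (analyticAt_inv (𝕜 := ℂ) hne').aeval_polynomial ((splinePoly n β).map (algebraMap ℝ ℂ))
    simpa using this
  refine han.analyticOrderAt_eq_one_of_zero_deriv_ne_zero
    ((h.mem_exponentialSplineZeros h0 h1 _).2 ⟨i, hi, rfl⟩).2 ?_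
  have hd := (((splinePoly n β).map (algebraMap ℝ ℂ)).hasDerivAt
    ((((r i)⁻¹ : ℝ) : ℂ)⁻¹)).comp _ (hasDerivAt_inv hne')
  rw [show exponentialSpline n β
    = (fun x => eval x ((splinePoly n β).map (algebraMap ℝ ℂ))) ∘ Inv.inv from hfun, hd.deriv]
  refine mul_ne_zero ?_ (neg_ne_zero.2 (inv_ne_zero (pow_ne_zero _ hne')))
  rw [Complex.ofReal_inv, inv_inv, derivative_map, eval_map_algebraMap,
    ← Complex.coe_algebraMap, aeval_algebraMap_apply, Complex.coe_algebraMap]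
  simp only [Complex.ofReal_ne_zero, coe_aeval_eq_eval]
  intro h'
  have := h.sign_eval_derivative hi
  rw [h', mul_zero] at this
  exact this.false

theorem HasNegRoots.encard_image {p : ℝ[X]} {n : ℕ} {r : ℕ → ℝ} (h : HasNegRoots p n r)
    {S : Finset ℕ} (hS : ∀ i ∈ S, i < n) :
    ((fun i => (((r i)⁻¹ : ℝ) : ℂ)) '' (S : Set ℕ)).encard = S.card := by
  rw [InjOn.encard_image, Set.encard_coe_eq_coe_finsetCard]
  intro i hi j hj hij
  have hij : r i = r j := inv_injective (Complex.ofReal_injective hij)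
  rcases lt_trichotomy i j with h' | h' | h'
  · linarith [h.lt i j h' (hS j hj)]
  · exact h'
  · linarith [h.lt j i h' (hS i hi)]

/-- Inversion sends roots in `(-1, 0)` to zeros outside the unit circle and roots below `-1` to
zeros inside it. -/
theorem HasNegRoots.encard_zeros {n k : ℕ} {β : ℝ} {r : ℕ → ℝ} (h0 : 0 < β)
    (h1 : β < 1) (h : HasNegRoots (splinePoly n β) n r) (hs : SplitsAt n k r) :
    {t ∈ exponentialSplineZeros n β | 1 < ‖t‖}.encard = (k : ℕ∞) ∧
      {t ∈ exponentialSplineZeros n β | ‖t‖ < 1}.encard = ((n - k : ℕ) : ℕ∞) := by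
  obtain ⟨hkn, hlow, hhigh⟩ := hs
  have hnorm : ∀ i < n, ‖(((r i)⁻¹ : ℝ) : ℂ)‖ = (-r i)⁻¹ := by
    intro i hi
    rw [Complex.norm_real, norm_inv, Real.norm_of_nonpos (h.neg i hi).le]
  have hbig : ∀ i < n, i < k → 1 < ‖(((r i)⁻¹ : ℝ) : ℂ)‖ := by
    intro i hi hik
    rw [hnorm i hi]
    exact (one_lt_inv₀ (by linarith [h.neg i hi])).2 (by linarith [hlow i hik])
  have hsmall : ∀ i < n, k ≤ i → ‖(((r i)⁻¹ : ℝ) : ℂ)‖ < 1 := by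
    intro i hi hik
    rw [hnorm i hi]
    exact inv_lt_one_of_one_lt₀ (by linarith [hhigh i hi hik])
  have e1 : {t ∈ exponentialSplineZeros n β | 1 < ‖t‖}
      = (fun i => (((r i)⁻¹ : ℝ) : ℂ)) '' (Finset.range k : Set ℕ) := by
    ext t
    simp only [mem_ofPred_eq, h.mem_exponentialSplineZeros h0 h1, mem_image, Finset.coe_range,
      mem_Iio]
    constructor
    · rintro ⟨⟨i, hi, rfl⟩, ht⟩
      exact ⟨i, by by_contra hik; linarith [hsmall i hi (not_lt.1 hik)], rfl⟩
    · rintro ⟨i, hi, rfl⟩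
      exact ⟨⟨i, by omega, rfl⟩, hbig i (by omega) hi⟩
  have e2 : {t ∈ exponentialSplineZeros n β | ‖t‖ < 1}
      = (fun i => (((r i)⁻¹ : ℝ) : ℂ)) '' (Finset.Ico k n : Set ℕ) := by
    ext t
    simp only [mem_ofPred_eq, h.mem_exponentialSplineZeros h0 h1, mem_image, Finset.coe_Ico,
      mem_Ico]
    constructor
    · rintro ⟨⟨i, hi, rfl⟩, ht⟩
      exact ⟨i, ⟨by by_contra hik; linarith [hbig i hi (not_le.1 hik)], hi⟩, rfl⟩
    · rintro ⟨i, hi, rfl⟩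
      exact ⟨⟨i, hi.2, rfl⟩, hsmall i hi.2 hi.1⟩
  rw [e1, e2, h.encard_image fun i hi => (Finset.mem_range.1 hi).trans_le hkn,
    h.encard_image fun i hi => (Finset.mem_Ico.1 hi).2]
  simp

theorem mainTheorem7 (m : ℕ) (hm : 2 ≤ m) :
    (∀ β : ℝ, 0 < β → β < 1 → ∀ t ∈ exponentialSplineZeros (m - 1) β,
      analyticOrderAt (exponentialSpline (m - 1) β) t = 1 ∧ ∃ r : ℝ, r < 0 ∧ t = (r : ℂ)) ∧
    (∀ β : ℝ, 0 < β → β < 1 / 2 →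
      {t ∈ exponentialSplineZeros (m - 1) β | 1 < ‖t‖}.encard = ((m / 2 : ℕ) : ℕ∞) ∧
      {t ∈ exponentialSplineZeros (m - 1) β | ‖t‖ < 1}.encard = (((m - 1) / 2 : ℕ) : ℕ∞)) ∧
    (∀ β : ℝ, 1 / 2 < β → β < 1 →
      {t ∈ exponentialSplineZeros (m - 1) β | 1 < ‖t‖}.encard = (((m - 1) / 2 : ℕ) : ℕ∞) ∧
      {t ∈ exponentialSplineZeros (m - 1) β | ‖t‖ < 1}.encard = ((m / 2 : ℕ) : ℕ∞)) := by
  obtain ⟨n, rfl⟩ : ∃ n, m = n + 1 := ⟨m - 1, by omega⟩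
  rw [Nat.add_sub_cancel]
  refine ⟨fun β h0 h1 t ht => ?_, fun β h0 h1 => ?_, fun β h0 h1 => ?_⟩
  · obtain ⟨r, hr⟩ := exists_hasNegRoots_splinePoly n h0 h1
    obtain ⟨i, hi, rfl⟩ := (hr.mem_exponentialSplineZeros h0 h1 t).1 ht
    exact ⟨hr.analyticOrderAt_eq_one h0 h1 hi, _, inv_lt_zero.2 (hr.neg i hi), rfl⟩
  -- The exponent in the sign of `P_n(-1)` serves as the number of roots in `(-1, 0)`, because it
  -- starts at `0` and grows by at most one per degree.
  · obtain ⟨r, hr, hs⟩ := exists_splitsAt_splinePoly (k := fun n => (n + 1) / 2) h0 (by linarith)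
      rfl (fun n => by omega) (fun n => sign_splineAlt_left n h0 h1) n
    have := hr.encard_zeros h0 (by linarith) hs
    rwa [show n - (n + 1) / 2 = n / 2 by omega] at this
  · obtain ⟨r, hr, hs⟩ := exists_splitsAt_splinePoly (k := fun n => n / 2) (by linarith) h1
      rfl (fun n => by omega) (fun n => sign_splineAlt_right n h0 h1) n
    have := hr.encard_zeros (by linarith) h1 hs
    rwa [show n - n / 2 = (n + 1) / 2 by omega] at this
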